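/- For partitions $\mu \subseteq \lambda$ with $|\lambda|-|\mu| = m$, let $\chi^{\lambda/\mu}$ be the character (over $\mathbb{C}$) of the skew Specht module of shape $\lambda/\mu$, a representation of the symmetric group $S_m$, and let $f^{\lambda/\mu} := \chi^{\lambda/\mu}(\mathrm{id})$ be its degree. For $\mu=\varnothing$ write $\chi^\lambda$ and $f^\lambda$; thus $\chi^\lambda$ is the irreducible character of $S_{|\lambda|}$ indexed by $\lambda$. Let $(1^j)$ denote the partition with $j$ parts equal to $1$. **Theorem.** Let $\lambda=(\lambda_1,\dots,\lambda_t)\vdash k$ be a partition of $k$ with exactly $t$ (positive) parts, let $n\ge\lambda_1$ be an integer (where $\lambda_1 := 0$ and $n\ge 0$ if $\lambda$ is empty), and let $(n,\lambda) := (n,\lambda_1,\dots,\lambda_t)\vdash n+k$. Then $$f^{(n,\lambda)}=\sum_{j=0}^{t}(-1)^j\binom{n+k}{k-j}\,f^{\lambda/(1^j)}.$$ -/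

import Mathlib

noncomputable section

namespace SkewSpecht

open Equiv

/-- The cells (row, column) of the skew shape `lam / mu`. -/
def cells (lam mu : YoungDiagram) : Finset (ℕ × ℕ) := lam.cells \ mu.cells

/-- The number of cells of the skew shape `lam / mu`. -/
def size (lam mu : YoungDiagram) : ℕ := (cells lam mu).card

/-- A (bijective) tableau of shape `D`: each of the numbers `0, …, m - 1` is put into one cell. -/
abbrev Tableau (D : Finset (ℕ × ℕ)) (m : ℕ) := D ≃ Fin m

/-- The row of `T` that contains the number `i`. -/
def Tableau.row {D : Finset (ℕ × ℕ)} {m : ℕ} (T : Tableau D m) (i : Fin m) : ℕ :=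
  (T.symm i).1.1

/-- The column of `T` that contains the number `i`. -/
def Tableau.col {D : Finset (ℕ × ℕ)} {m : ℕ} (T : Tableau D m) (i : Fin m) : ℕ :=
  (T.symm i).1.2

/-- The vector space with basis the maps `Fin m → ℕ`. The tabloid of a tableau `T`, that is `T` up
to permutations inside its rows, is encoded by the map `T.row` sending a number to its row, so the
tabloids of any given shape are part of the basis. -/
abbrev TabloidSpace (m : ℕ) : Type := (Fin m → ℕ) →₀ ℂ

/-- The symmetric group acts on tabloids by permuting the numbers. -/
def tabloidRep (m : ℕ) : Representation ℂ (Perm (Fin m)) (TabloidSpace m) where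
  toFun s := Finsupp.lmapDomain ℂ ℂ fun w i => w (s⁻¹ i)
  map_one' := by
    ext w
    simp
  map_mul' s t := by
    ext w
    simp [Finsupp.mapDomain_single]

/-- The tableau `s T` in which every number `i` of `T` is replaced by `s i`. -/
def Tableau.act {D : Finset (ℕ × ℕ)} {m : ℕ} (s : Perm (Fin m)) (T : Tableau D m) :
    Tableau D m := T.trans s

open Classical in
/-- The column group of `T`: permutations of the numbers that preserve each column of `T`. -/
def Tableau.colGroup {D : Finset (ℕ × ℕ)} {m : ℕ} (T : Tableau D m) :
    Finset (Perm (Fin m)) :=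
  Finset.univ.filter fun p => ∀ i, T.col (p i) = T.col i

/-- The polytabloid of `T`: the sum over the column group of `T` of `sign p` times the tabloid of
`p T`. -/
def Tableau.polytabloid {D : Finset (ℕ × ℕ)} {m : ℕ} (T : Tableau D m) : TabloidSpace m :=
  ∑ p ∈ T.colGroup, Finsupp.single ((T.act p).row) (((Perm.sign p : ℤˣ) : ℤ) : ℂ)

theorem row_act {D : Finset (ℕ × ℕ)} {m : ℕ} (s : Perm (Fin m)) (T : Tableau D m) :
    (T.act s).row = fun i => T.row (s⁻¹ i) := rfl

theorem col_act {D : Finset (ℕ × ℕ)} {m : ℕ} (s : Perm (Fin m)) (T : Tableau D m) :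
    (T.act s).col = fun i => T.col (s⁻¹ i) := rfl

theorem tabloidRep_polytabloid {D : Finset (ℕ × ℕ)} {m : ℕ} (s : Perm (Fin m))
    (T : Tableau D m) : tabloidRep m s T.polytabloid = (T.act s).polytabloid := by
  unfold Tableau.polytabloid
  rw [map_sum]
  refine Finset.sum_bij' (fun p _ => s * p * s⁻¹) (fun p _ => s⁻¹ * p * s) ?_ ?_ ?_ ?_ ?_
  · intro p hp
    simp only [Tableau.colGroup, Finset.mem_filter, Finset.mem_univ, true_and] at hp ⊢
    intro i
    simp [col_act, hp]
  · intro p hp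
    simp only [Tableau.colGroup, Finset.mem_filter, Finset.mem_univ, true_and] at hp ⊢
    intro i
    simpa [col_act] using hp (s i)
  · intro p _
    group
  · intro p _
    group
  · intro p _
    simp only [tabloidRep, MonoidHom.coe_mk, OneHom.coe_mk, Finsupp.lmapDomain_apply,
      Finsupp.mapDomain_single, row_act]
    congr 1
    · funext i
      simp
    · simp [mul_right_comm]

/-- The Specht module of the skew shape `lam / mu`: the span of its polytabloids. -/
def spechtModule (lam mu : YoungDiagram) : Submodule ℂ (TabloidSpace (size lam mu)) :=
  Submodule.span ℂ (Set.range (Tableau.polytabloid (D := cells lam mu) (m := size lam mu)))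

theorem spechtModule_le_comap (lam mu : YoungDiagram) (s : Perm (Fin (size lam mu))) :
    spechtModule lam mu ≤ (spechtModule lam mu).comap (tabloidRep (size lam mu) s) := by
  refine Submodule.span_le.2 ?_
  rintro _ ⟨T, rfl⟩
  exact Submodule.subset_span ⟨T.act s, (tabloidRep_polytabloid s T).symm⟩

/-- The action of the symmetric group on the Specht module of `lam / mu`. -/
def spechtRep (lam mu : YoungDiagram) :
    Representation ℂ (Perm (Fin (size lam mu))) (spechtModule lam mu) :=
  (tabloidRep (size lam mu)).subrepresentation (spechtModule lam mu)
    (spechtModule_le_comap lam mu)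

/-- The character `χ^{lam/mu}` of the symmetric group on `|lam/mu|` numbers. -/
def chi (lam mu : YoungDiagram) (s : Perm (Fin (size lam mu))) : ℂ :=
  Representation.character (V := spechtModule lam mu) (spechtRep lam mu) s

/-- The degree `f^{lam/mu} = χ^{lam/mu}(id)`. -/
def skewDegree (lam mu : YoungDiagram) : ℂ := chi lam mu 1

/-- The degree `f^lam = χ^lam(id)` of the irreducible character of the partition `lam`. -/
def degree (lam : YoungDiagram) : ℂ := skewDegree lam ⊥

/-- The one-column partition `(1^j)`. -/
def column (j : ℕ) : YoungDiagram :=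
  YoungDiagram.ofRowLens (List.replicate j 1)
    (List.Pairwise.sortedGE (List.pairwise_replicate.2 (Or.inr (le_refl 1))))

theorem sortedGE_cons {n : ℕ} {lam : YoungDiagram} (hn : lam.rowLen 0 ≤ n) :
    (n :: lam.rowLens).SortedGE := by
  refine List.Pairwise.sortedGE (List.pairwise_cons.2 ⟨?_, lam.rowLens_sorted.pairwise⟩)
  intro x hx
  simp only [YoungDiagram.rowLens, List.mem_map, List.mem_range] at hx
  obtain ⟨i, -, rfl⟩ := hx
  exact (lam.rowLen_anti 0 i (Nat.zero_le i)).trans hn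

/-- The partition `(n, lam) = (n, lam_1, …, lam_t)`, for `n ≥ lam_1`. -/
def addRow (n : ℕ) (lam : YoungDiagram) (hn : lam.rowLen 0 ≤ n) : YoungDiagram :=
  YoungDiagram.ofRowLens (n :: lam.rowLens) (sortedGE_cons hn)

end SkewSpecht

end

/-!
The degree of a skew Specht module is the number of standard tableaux of its shape, because the
standard polytabloids form a basis. They are independent since the tabloid of a standard tableau `T`
is the lexicographically smallest one in the polytabloid of `T`
(`linearIndependent_polytabloid`). They span by the Garnir relations, which hold for every shape
that is order-connected in `ℕ × ℕ` (`Tableau.garnir`, `polytabloid_mem_span`).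

The number of standard tableaux with `m` cells and row lengths `a` (outer) and `b` (inner) is
`m! * det (1 / (a_i - b_j - i + j)!)`, Aitken's formula (`card_standardWords_shape`). Both sides
satisfy the same recursion: the largest entry of a standard tableau sits in a corner, and `m` times
the determinant is the sum of the determinants in which one row length is lowered by one, which
vanish unless that row ends in a corner.

For the shape `(n, lam)`, expand this determinant along the row of `n`. The entry in column `j` is
`1 / (n + j)!`, and the complementary minor is the Aitken determinant of `lam / (1^j)`, because
deleting column `j` shifts the columns from `j` on by one, which amounts to `b = (1^j)`. Putting in
the factorials turns the coefficients into the binomial coefficients of the theorem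
(`det_aitken_cons`, `degree_addRow`).
-/

noncomputable section

namespace SkewSpecht

open Equiv

section StandardBasis

/-! ### Linear independence of the standard polytabloids -/

variable {D : Finset (ℕ × ℕ)} {m : ℕ}

/-- A tableau is standard if its entries increase along rows and down columns. -/
def Tableau.IsStandard (T : Tableau D m) : Prop :=
  (∀ i j, T.row i = T.row j → T.col i < T.col j → i < j) ∧
    ∀ i j, T.col i = T.col j → T.row i < T.row j → i < j

theorem Tableau.ext_row_col (T : Tableau D m) {i j : Fin m} (hr : T.row i = T.row j)
    (hc : T.col i = T.col j) : i = j :=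
  T.symm.injective (Subtype.ext (Prod.ext hr hc))

theorem Tableau.exists_cell (T : Tableau D m) {r c : ℕ} (h : (r, c) ∈ D) :
    ∃ i, T.row i = r ∧ T.col i = c :=
  ⟨T ⟨(r, c), h⟩, by simp [Tableau.row], by simp [Tableau.col]⟩

theorem Tableau.cell_mem (T : Tableau D m) (i : Fin m) : (T.row i, T.col i) ∈ D :=
  (T.symm i).2

theorem Tableau.mem_colGroup {T : Tableau D m} {p : Perm (Fin m)} :
    p ∈ T.colGroup ↔ ∀ i, T.col (p i) = T.col i := by
  simp [Tableau.colGroup]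

theorem Tableau.col_inv {T : Tableau D m} {p : Perm (Fin m)} (hp : p ∈ T.colGroup) (i : Fin m) :
    T.col (p⁻¹ i) = T.col i := by
  rw [← Tableau.mem_colGroup.1 hp (p⁻¹ i)]
  simp

/-- In a standard tableau, moving entries inside their columns makes the row function
lexicographically larger. -/
theorem Tableau.IsStandard.row_lt_row_act {T : Tableau D m} (hT : T.IsStandard)
    {p : Perm (Fin m)} (hp : p ∈ T.colGroup) (h1 : p ≠ 1) :
    toLex T.row < toLex (T.act p).row := by
  have fixed : ∀ j, (T.act p).row j = T.row j → p⁻¹ j = j := fun j hj =>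
    T.ext_row_col hj (T.col_inv hp j)
  rcases lt_trichotomy (toLex T.row) (toLex (T.act p).row) with h | h | h
  · exact h
  · refine absurd ?_ h1
    have h' : T.row = (T.act p).row := toLex.injective h
    rw [← inv_eq_one]
    ext j
    simp [fixed j (congrFun h' j).symm]
  · obtain ⟨i, hi, hlt⟩ := h
    have hlt' : T.row (p⁻¹ i) < T.row i := hlt
    have h2 : p⁻¹ i < i := hT.2 _ _ (T.col_inv hp i) hlt'
    have h3 := p⁻¹.injective (fixed _ (hi _ h2))
    exact absurd h3 h2.ne

theorem Tableau.IsStandard.polytabloid_apply_row {T : Tableau D m} (hT : T.IsStandard) :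
    T.polytabloid T.row = 1 := by
  rw [Tableau.polytabloid, Finsupp.finsetSum_apply, Finset.sum_eq_single 1]
  · simp [row_act]
  · intro p hp h1
    rw [Finsupp.single_eq_of_ne]
    intro h
    exact (hT.row_lt_row_act hp h1).ne (congrArg toLex h)
  · intro h
    exact absurd (Tableau.mem_colGroup.2 fun i => rfl) h

theorem Tableau.IsStandard.row_le_of_polytabloid_ne_zero {T : Tableau D m} (hT : T.IsStandard)
    {w : Fin m → ℕ} (hw : T.polytabloid w ≠ 0) : toLex T.row ≤ toLex w := by
  rw [Tableau.polytabloid, Finsupp.finsetSum_apply] at hw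
  obtain ⟨p, hp, hne⟩ := Finset.exists_ne_zero_of_sum_ne_zero hw
  obtain rfl : (T.act p).row = w := by
    by_contra h
    exact hne (Finsupp.single_eq_of_ne (Ne.symm h))
  by_cases h1 : p = 1
  · subst h1
    exact le_of_eq rfl
  · exact (hT.row_lt_row_act hp h1).le

/-- A standard tableau is determined by its tabloid, because each row is increasing. -/
theorem Tableau.IsStandard.row_injective {T U : Tableau D m} (hT : T.IsStandard)
    (hU : U.IsStandard) (h : T.row = U.row) : T = U := by
  -- If `i` is the least entry whose column differs, and it lies further left in `T`, then `U` fills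
  -- that cell with an entry `j < i`, which has the same cell in `T`.
  have key : ∀ (T U : Tableau D m), T.IsStandard → U.IsStandard → T.row = U.row →
      ∀ i, (∀ j < i, T.col j = U.col j) → ¬ T.col i < U.col i := by
    intro T U hT hU h i hi hlt
    obtain ⟨j, hjr, hjc⟩ := U.exists_cell (T.cell_mem i)
    have hji : j < i := hU.1 _ _ (by rw [hjr, h]) (by rw [hjc]; exact hlt)
    have : j = i := T.ext_row_col (by rw [h, hjr, h]) (by rw [hi j hji, hjc])
    exact hji.ne this
  have hcol : T.col = U.col := by
    rcases lt_trichotomy (toLex T.col) (toLex U.col) with hl | hl | hl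
    · obtain ⟨i, hi, hlt⟩ := hl
      exact absurd hlt (key T U hT hU h i hi)
    · exact toLex.injective hl
    · obtain ⟨i, hi, hlt⟩ := hl
      exact absurd hlt (key U T hU hT h.symm i hi)
  have : T.symm = U.symm := Equiv.ext fun i =>
    Subtype.ext (Prod.ext (congrFun h i) (congrFun hcol i))
  simpa using congrArg Equiv.symm this

/-- The standard polytabloids have distinct lexicographically smallest tabloids, so they are
linearly independent. -/
theorem linearIndependent_polytabloid :
    LinearIndependent ℂ fun T : {T : Tableau D m // T.IsStandard} => T.1.polytabloid := by
  classical
  rw [Fintype.linearIndependent_iff]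
  intro g hg
  by_contra! hne
  obtain ⟨T₀, hT₀⟩ := hne
  -- The lexicographically smallest row function among the tableaux that occur survives.
  obtain ⟨T, hT, hmin⟩ := Set.exists_min_image {T | g T ≠ 0}
    (fun T : {T : Tableau D m // T.IsStandard} => toLex T.1.row) (Set.toFinite _) ⟨T₀, hT₀⟩
  have h0 := congrArg (fun v => v T.1.row) hg
  simp only [Finsupp.finsetSum_apply, Finsupp.smul_apply, Finsupp.coe_zero, Pi.zero_apply] at h0
  rw [Finset.sum_eq_single T, T.2.polytabloid_apply_row] at h0
  · exact hT (by simpa using h0)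
  · intro U _ hUT
    by_contra hU
    have hgU : g U ≠ 0 := left_ne_zero_of_smul hU
    have h1 := U.2.row_le_of_polytabloid_ne_zero (right_ne_zero_of_smul hU)
    have h2 := le_antisymm h1 (hmin U hgU)
    exact hUT (Subtype.ext (U.2.row_injective T.2 (toLex.injective h2)))
  · simp

/-! ### Garnir relations and straightening -/

theorem Tableau.act_act (T : Tableau D m) (s s' : Perm (Fin m)) :
    (T.act s).act s' = T.act (s' * s) := rfl

theorem sign_mul_self_cast (p : Perm (Fin m)) :
    (((Perm.sign p : ℤˣ) : ℤ) : ℂ) * (((Perm.sign p : ℤˣ) : ℤ) : ℂ) = 1 := by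
  rw [← Int.cast_mul, ← Units.val_mul, Int.units_mul_self]
  simp

theorem Tableau.polytabloid_act_of_mem_colGroup {T : Tableau D m} {p : Perm (Fin m)}
    (hp : p ∈ T.colGroup) :
    (T.act p).polytabloid = (((Perm.sign p : ℤˣ) : ℤ) : ℂ) • T.polytabloid := by
  unfold Tableau.polytabloid
  rw [Finset.smul_sum]
  have hcol : (T.act p).col = T.col := funext (T.col_inv hp)
  refine Finset.sum_bij' (fun q _ => q * p) (fun q _ => q * p⁻¹) ?_ ?_ ?_ ?_ ?_
  · intro q hq
    simp only [Tableau.mem_colGroup, hcol] at hq hp ⊢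
    intro i
    simp [hq, hp]
  · intro q hq
    simp only [Tableau.mem_colGroup, hcol] at hq ⊢
    intro i
    rw [Perm.mul_apply, hq, T.col_inv hp]
  · intro q _
    simp
  · intro q _
    simp
  · intro q _
    rw [Tableau.act_act, Finsupp.smul_single]
    congr 1
    rw [Perm.sign_mul]
    push_cast
    rw [smul_eq_mul]
    linear_combination -(((Perm.sign q : ℤˣ) : ℤ) : ℂ) * sign_mul_self_cast p

open Classical in
/-- The permutations of `Fin m` that move only elements of `X`. -/
def permsOn (X : Finset (Fin m)) : Finset (Perm (Fin m)) :=
  Finset.univ.filter fun s => ∀ i, i ∉ X → s i = i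

theorem mem_permsOn {X : Finset (Fin m)} {s : Perm (Fin m)} :
    s ∈ permsOn X ↔ ∀ i, i ∉ X → s i = i := by
  simp [permsOn]

theorem inv_mem_permsOn {X : Finset (Fin m)} {s : Perm (Fin m)} (hs : s ∈ permsOn X) :
    s⁻¹ ∈ permsOn X :=
  mem_permsOn.2 fun i hi => by rw [Perm.inv_eq_iff_eq, mem_permsOn.1 hs i hi]

theorem apply_mem_of_mem_permsOn {X : Finset (Fin m)} {s : Perm (Fin m)} (hs : s ∈ permsOn X)
    {i : Fin m} (hi : i ∈ X) : s i ∈ X := by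
  by_contra h
  have := s.injective (mem_permsOn.1 hs _ h)
  exact h (this.symm ▸ hi)

/-- Antisymmetrizing a tabloid over a set with two elements in the same row gives zero. -/
theorem sum_permsOn_single_eq_zero {X : Finset (Fin m)} {w : Fin m → ℕ} {i j : Fin m}
    (hi : i ∈ X) (hj : j ∈ X) (hij : i ≠ j) (hw : w i = w j) :
    ∑ s ∈ permsOn X, (((Perm.sign s : ℤˣ) : ℤ) : ℂ) •
      (Finsupp.single (fun l => w (s⁻¹ l)) 1 : TabloidSpace m) = 0 := by
  have hws : ∀ l, w (swap i j l) = w l := by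
    intro l
    rw [swap_apply_def]
    split_ifs with h1 h2
    · rw [h1, hw]
    · rw [h2, hw]
    · rfl
  refine Finset.sum_involution (fun s _ => s * swap i j) ?_ ?_ ?_ ?_
  · intro s _
    simp [hws, hij]
  · intro s _ _ h
    have h1 : swap i j = 1 := by simpa using h
    exact hij (by simpa using h1)
  · intro s hs
    rw [mem_permsOn] at hs ⊢
    intro l hl
    rw [Perm.mul_apply, swap_apply_of_ne_of_ne (by rintro rfl; exact hl hi)
      (by rintro rfl; exact hl hj),
      hs l hl]
  · intro s _
    simp

/-- The entries in column `c` at or below row `r`, together with those in column `c'` at or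
above row `r`. -/
def Tableau.garnirSet (T : Tableau D m) (r c c' : ℕ) : Finset (Fin m) :=
  Finset.univ.filter fun i => (T.col i = c ∧ r ≤ T.row i) ∨ (T.col i = c' ∧ T.row i ≤ r)

theorem Tableau.mem_garnirSet {T : Tableau D m} {r c c' : ℕ} {i : Fin m} :
    i ∈ T.garnirSet r c c' ↔
      (T.col i = c ∧ r ≤ T.row i) ∨ (T.col i = c' ∧ T.row i ≤ r) := by
  simp [Tableau.garnirSet]

/-- The number of elements of the Garnir set exceeds the number of rows meeting the two columns,
so after any column permutation two of its elements share a row. -/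
theorem Tableau.exists_same_row (hD : Set.OrdConnected (D : Set (ℕ × ℕ))) (T : Tableau D m)
    {r c c' : ℕ} (hcc : c < c') (hc : (r, c) ∈ D) (hc' : (r, c') ∈ D) {p : Perm (Fin m)}
    (hp : p ∈ T.colGroup) :
    ∃ i ∈ T.garnirSet r c c', ∃ j ∈ T.garnirSet r c c', i ≠ j ∧
      (T.act p).row i = (T.act p).row j := by
  classical
  let A : Finset (Fin m) := Finset.univ.filter fun i => T.col i = c ∧ r ≤ T.row i
  let B : Finset (Fin m) := Finset.univ.filter fun i => T.col i = c' ∧ T.row i ≤ r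
  have hAB : T.garnirSet r c c' = A ∪ B := by
    ext i
    simp [Tableau.mem_garnirSet, A, B]
  have hdisj : Disjoint A B := by
    rw [Finset.disjoint_left]
    intro i hiA hiB
    simp only [A, B, Finset.mem_filter, Finset.mem_univ, true_and] at hiA hiB
    omega
  have hrA : r ∈ A.image T.row := by
    obtain ⟨i, h1, h2⟩ := T.exists_cell hc
    exact Finset.mem_image.2 ⟨i, by simp [A, h1, h2], h1⟩
  have hrB : r ∈ B.image T.row := by
    obtain ⟨i, h1, h2⟩ := T.exists_cell hc'
    exact Finset.mem_image.2 ⟨i, by simp [B, h1, h2], h1⟩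
  have hcard : (A.image T.row ∪ B.image T.row).card < (T.garnirSet r c c').card := by
    have h1 := Finset.card_union_add_card_inter (A.image T.row) (B.image T.row)
    have h2 : 0 < (A.image T.row ∩ B.image T.row).card :=
      Finset.card_pos.2 ⟨r, Finset.mem_inter.2 ⟨hrA, hrB⟩⟩
    have h3 : (A.image T.row).card ≤ A.card := Finset.card_image_le
    have h4 : (B.image T.row).card ≤ B.card := Finset.card_image_le
    rw [hAB, Finset.card_union_of_disjoint hdisj]
    omega
  obtain ⟨i, hi, j, hj, hij, h⟩ := Finset.exists_ne_map_eq_of_card_lt_of_maps_to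
    (f := (T.act p).row) hcard (by
      intro i hi
      have hcell := T.cell_mem (p⁻¹ i)
      rw [T.col_inv hp] at hcell
      have hcol : T.col i = c ∨ T.col i = c' := by
        rcases Tableau.mem_garnirSet.1 hi with h | h
        exacts [Or.inl h.1, Or.inr h.1]
      change T.row (p⁻¹ i) ∈ _
      rw [Finset.mem_coe, Finset.mem_union]
      rcases le_total r (T.row (p⁻¹ i)) with hr | hr
      · left
        have : (T.row (p⁻¹ i), c) ∈ D := by
          rcases hcol with h | h
          · rwa [h] at hcell
          · rw [h] at hcell
            exact hD.out hc hcell ⟨⟨hr, le_rfl⟩, ⟨le_rfl, hcc.le⟩⟩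
        obtain ⟨j, h1, h2⟩ := T.exists_cell this
        exact Finset.mem_image.2 ⟨j, by simpa [A, h1, h2] using hr, h1⟩
      · right
        have : (T.row (p⁻¹ i), c') ∈ D := by
          rcases hcol with h | h
          · rw [h] at hcell
            exact hD.out hcell hc' ⟨⟨le_rfl, hcc.le⟩, ⟨hr, le_rfl⟩⟩
          · rwa [h] at hcell
        obtain ⟨j, h1, h2⟩ := T.exists_cell this
        exact Finset.mem_image.2 ⟨j, by simpa [B, h1, h2] using hr, h1⟩)
  exact ⟨i, hi, j, hj, hij, h⟩

/-- The Garnir relation: antisymmetrizing a polytabloid over a Garnir set gives zero. The sum runs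
over all permutations of the set, not over coset representatives; this only costs a positive
integer factor later. -/
theorem Tableau.garnir (hD : Set.OrdConnected (D : Set (ℕ × ℕ))) (T : Tableau D m)
    {r c c' : ℕ} (hcc : c < c') (hc : (r, c) ∈ D) (hc' : (r, c') ∈ D) :
    ∑ s ∈ permsOn (T.garnirSet r c c'),
      (((Perm.sign s : ℤˣ) : ℤ) : ℂ) • (T.act s).polytabloid = 0 := by
  have h : ∀ s : Perm (Fin m), (T.act s).polytabloid = ∑ p ∈ T.colGroup,
      (((Perm.sign p : ℤˣ) : ℤ) : ℂ) •
        (Finsupp.single (fun l => (T.act p).row (s⁻¹ l)) 1 : TabloidSpace m) := by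
    intro s
    rw [← tabloidRep_polytabloid, Tableau.polytabloid, map_sum]
    refine Finset.sum_congr rfl fun p _ => ?_
    simp [tabloidRep, Finsupp.mapDomain_single]
  simp only [h, Finset.smul_sum]
  rw [Finset.sum_comm]
  refine Finset.sum_eq_zero fun p hp => ?_
  simp only [smul_comm _ (((Perm.sign p : ℤˣ) : ℤ) : ℂ)]
  rw [← Finset.smul_sum]
  obtain ⟨i, hi, j, hj, hij, hrow⟩ := T.exists_same_row hD hcc hc hc' hp
  rw [sum_permsOn_single_eq_zero hi hj hij hrow, smul_zero]

/-- If the columns of `T` increase but the entries `a` and `b` form a descent in a row, a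
permutation of the Garnir set either preserves the columns or makes the column function
lexicographically smaller. -/
theorem Tableau.mem_colGroup_or_col_act_lt {T : Tableau D m}
    (hcol : ∀ i j, T.col i = T.col j → T.row i < T.row j → i < j)
    {a b : Fin m} (hab : T.row a = T.row b) (hcc : T.col a < T.col b) (hlt : b < a)
    {s : Perm (Fin m)} (hs : s ∈ permsOn (T.garnirSet (T.row a) (T.col a) (T.col b))) :
    s ∈ T.colGroup ∨ toLex (T.act s).col < toLex T.col := by
  classical
  rcases lt_trichotomy (toLex (T.act s).col) (toLex T.col) with h | h | h
  · exact Or.inr h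
  · refine Or.inl (Tableau.mem_colGroup.2 fun i => ?_)
    have := congrFun (toLex.injective h) (s i)
    simpa [col_act] using this.symm
  · exfalso
    obtain ⟨i, hi, hil⟩ := h
    have hil' : T.col i < T.col (s⁻¹ i) := hil
    have hs' := inv_mem_permsOn hs
    have hmono : ∀ x y, T.col x = T.col y → T.row x ≤ T.row y → x ≤ y := by
      intro x y h1 h2
      rcases h2.lt_or_eq with h2 | h2
      · exact (hcol x y h1 h2).le
      · exact (T.ext_row_col h2 h1).le
    have hiX : i ∈ T.garnirSet (T.row a) (T.col a) (T.col b) := by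
      by_contra hiX
      rw [mem_permsOn.1 hs' i hiX] at hil'
      exact hil'.ne rfl
    have hiX' := apply_mem_of_mem_permsOn hs' hiX
    rw [Tableau.mem_garnirSet] at hiX hiX'
    have hia : T.col i = T.col a ∧ T.row a ≤ T.row i := by omega
    have hib : T.col (s⁻¹ i) = T.col b ∧ T.row (s⁻¹ i) ≤ T.row a := by omega
    -- At the least entry `i` whose column changes, the column grows, so `i` lies in the left column.
    -- The entries `B` of the Garnir set in the right column are all smaller than `i`, so `s⁻¹` maps
    -- `B` into itself, hence onto itself, and `s⁻¹ i ∈ B` forces `i ∈ B`.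
    let B : Finset (Fin m) := Finset.univ.filter fun j => T.col j = T.col b ∧ T.row j ≤ T.row a
    have hB : ∀ j ∈ B, s⁻¹ j ∈ B := by
      intro j hj
      simp only [B, Finset.mem_filter, Finset.mem_univ, true_and] at hj ⊢
      have h1 : j ≤ b := hmono j b hj.1 (hab ▸ hj.2)
      have h2 : a ≤ i := hmono a i hia.1.symm hia.2
      have h3 : T.col j = T.col (s⁻¹ j) := hi j (h1.trans_lt (hlt.trans_le h2))
      have h4 := apply_mem_of_mem_permsOn hs' (Tableau.mem_garnirSet.2 (Or.inr hj))
      rw [Tableau.mem_garnirSet] at h4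
      omega
    have himage : B.image (s⁻¹ : Perm (Fin m)) = B :=
      Finset.eq_of_subset_of_card_le (Finset.image_subset_iff.2 hB)
        (Finset.card_image_of_injective _ s⁻¹.injective).ge
    have hmem : s⁻¹ i ∈ B.image (s⁻¹ : Perm (Fin m)) := by
      rw [himage]
      simpa [B] using hib
    obtain ⟨j, hj, hji⟩ := Finset.mem_image.1 hmem
    rw [s⁻¹.injective hji] at hj
    simp only [B, Finset.mem_filter, Finset.mem_univ, true_and] at hj
    omega

/-- Straightening: a tableau outside the span that is minimal for the lexicographic order on
(column function, row function) would have increasing columns and, by the Garnir relation,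
increasing rows. -/
theorem polytabloid_mem_span (hD : Set.OrdConnected (D : Set (ℕ × ℕ))) (T : Tableau D m) :
    T.polytabloid ∈ Submodule.span ℂ
      (Set.range fun T : {T : Tableau D m // T.IsStandard} => T.1.polytabloid) := by
  classical
  by_contra hT
  set V := Submodule.span ℂ
      (Set.range fun T : {T : Tableau D m // T.IsStandard} => T.1.polytabloid) with hV
  obtain ⟨T, hT, hmin⟩ := Set.exists_min_image {T : Tableau D m | T.polytabloid ∉ V}
    (fun T => toLex (toLex T.col, toLex T.row)) (Set.toFinite _) ⟨T, hT⟩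
  have hmem : ∀ U : Tableau D m, toLex (toLex U.col, toLex U.row) <
      toLex (toLex T.col, toLex T.row) → U.polytabloid ∈ V := by
    intro U hU
    by_contra h
    exact (hmin U h).not_gt hU
  refine hT ?_
  by_cases hcol : ∀ i j, T.col i = T.col j → T.row i < T.row j → i < j
  · by_cases hrow : ∀ i j, T.row i = T.row j → T.col i < T.col j → i < j
    · exact Submodule.subset_span ⟨⟨T, hrow, hcol⟩, rfl⟩
    · push Not at hrow
      obtain ⟨a, b, hab, hcc, hba⟩ := hrow
      have hlt : b < a := lt_of_le_of_ne hba fun h => by simp [h] at hcc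
      have hg := T.garnir hD hcc (T.cell_mem a) (hab ▸ T.cell_mem b)
      set S := permsOn (T.garnirSet (T.row a) (T.col a) (T.col b)) with hS
      -- The permutations in the column group contribute a positive multiple of the polytabloid of
      -- `T`, the others contribute polytabloids of smaller tableaux.
      rw [← Finset.sum_filter_add_sum_filter_not S (fun s => s ∈ T.colGroup)] at hg
      have h1 : ∑ s ∈ S.filter (fun s => s ∈ T.colGroup),
          (((Perm.sign s : ℤˣ) : ℤ) : ℂ) • (T.act s).polytabloid =
            ((S.filter (fun s => s ∈ T.colGroup)).card : ℂ) • T.polytabloid := by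
        rw [Finset.sum_congr rfl (g := fun _ => T.polytabloid), Finset.sum_const,
          Nat.cast_smul_eq_nsmul]
        intro s hs
        rw [Tableau.polytabloid_act_of_mem_colGroup (Finset.mem_filter.1 hs).2, smul_smul,
          sign_mul_self_cast, one_smul]
      have h2 : ∑ s ∈ S.filter (fun s => s ∉ T.colGroup),
          (((Perm.sign s : ℤˣ) : ℤ) : ℂ) • (T.act s).polytabloid ∈ V := by
        refine Submodule.sum_mem _ fun s hs => Submodule.smul_mem _ _ (hmem _ ?_)
        rw [Finset.mem_filter] at hs
        have := (T.mem_colGroup_or_col_act_lt hcol hab hcc hlt hs.1).resolve_left hs.2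
        exact Prod.Lex.toLex_lt_toLex.2 (Or.inl this)
      have hpos : ((S.filter (fun s => s ∈ T.colGroup)).card : ℂ) ≠ 0 := by
        rw [Nat.cast_ne_zero]
        refine (Finset.card_pos.2 ⟨1, ?_⟩).ne'
        exact Finset.mem_filter.2 ⟨mem_permsOn.2 fun i _ => rfl,
          Tableau.mem_colGroup.2 fun i => rfl⟩
      rw [h1] at hg
      rw [← Submodule.smul_mem_iff V hpos, eq_neg_of_add_eq_zero_left hg]
      exact V.neg_mem h2
  · -- Exchanging two entries that are out of order in a column only changes the sign.
    push Not at hcol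
    obtain ⟨a, b, hab, hrr, hba⟩ := hcol
    have hlt : b < a := lt_of_le_of_ne hba fun h => by simp [h] at hrr
    have hp : swap a b ∈ T.colGroup := by
      refine Tableau.mem_colGroup.2 fun i => ?_
      rw [swap_apply_def]
      split_ifs with h1 h2
      · rw [h1, hab]
      · rw [h2, hab]
      · rfl
    have h1 : (T.act (swap a b)).polytabloid ∈ V := by
      refine hmem _ (Prod.Lex.toLex_lt_toLex.2 (Or.inr ⟨?_, ?_⟩))
      · exact congrArg toLex (funext (T.col_inv hp))
      · refine ⟨b, fun j hj => ?_, ?_⟩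
        · change T.row ((swap a b)⁻¹ j) = T.row j
          rw [swap_inv, swap_apply_of_ne_of_ne (hj.trans hlt).ne hj.ne]
        · change T.row ((swap a b)⁻¹ b) < T.row b
          rwa [swap_inv, swap_apply_right]
    rw [Tableau.polytabloid_act_of_mem_colGroup hp] at h1
    have hne : (((Perm.sign (swap a b) : ℤˣ) : ℤ) : ℂ) ≠ 0 := by
      exact_mod_cast (Perm.sign (swap a b)).ne_zero
    exact (Submodule.smul_mem_iff V hne).1 h1

theorem ordConnected_cells (lam mu : YoungDiagram) :
    Set.OrdConnected (cells lam mu : Set (ℕ × ℕ)) := by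
  refine ⟨fun x hx y hy z hz => ?_⟩
  simp only [cells, Finset.coe_sdiff, Set.mem_sdiff, Finset.mem_coe, YoungDiagram.mem_cells]
    at hx hy ⊢
  exact ⟨lam.isLowerSet hz.2 hy.1, fun h => hx.2 (mu.isLowerSet hz.1 h)⟩

/-- The standard polytabloids are a basis of the skew Specht module. -/
theorem skewDegree_eq_card (lam mu : YoungDiagram) :
    skewDegree lam mu =
      Nat.card {T : Tableau (cells lam mu) (size lam mu) // T.IsStandard} := by
  classical
  have hspan : spechtModule lam mu = Submodule.span ℂ (Set.range fun
      T : {T : Tableau (cells lam mu) (size lam mu) // T.IsStandard} => T.1.polytabloid) := by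
    refine le_antisymm (Submodule.span_le.2 ?_) (Submodule.span_mono ?_)
    · rintro _ ⟨T, rfl⟩
      exact polytabloid_mem_span (ordConnected_cells lam mu) T
    · rintro _ ⟨T, rfl⟩
      exact ⟨T.1, rfl⟩
  have h : skewDegree lam mu = Module.finrank ℂ (spechtModule lam mu) := by
    have : Module.Finite ℂ (spechtModule lam mu) :=
      Module.Finite.span_of_finite ℂ (Set.finite_range _)
    have : Module.Free ℂ (spechtModule lam mu) :=
      Module.Free.of_divisionRing ℂ (spechtModule lam mu)
    rw [skewDegree, chi, Representation.character, map_one]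
    exact LinearMap.trace_one ℂ (spechtModule lam mu)
  rw [h, hspan, finrank_span_eq_card linearIndependent_polytabloid, Nat.card_eq_fintype_card]

end StandardBasis

section Counting

/-! ### Counting standard tableaux -/

/-- The cell `x` comes before `y` in the same row or in the same column. -/
def Before (x y : ℕ × ℕ) : Prop :=
  (x.1 = y.1 ∧ x.2 < y.2) ∨ (x.2 = y.2 ∧ x.1 < y.1)

/-- The standard tableaux of shape `D`, as enumerations of the cells of `D` in the order of
their entries. -/
def standardWords (D : Finset (ℕ × ℕ)) (m : ℕ) : Set (Fin m → ℕ × ℕ) :=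
  {g | Function.Injective g ∧ Set.range g = D ∧ ∀ i j, Before (g i) (g j) → i < j}

theorem card_isStandard (D : Finset (ℕ × ℕ)) (m : ℕ) :
    Nat.card {T : Tableau D m // T.IsStandard} = Nat.card (standardWords D m) := by
  let F : {T : Tableau D m // T.IsStandard} → standardWords D m := fun T =>
    ⟨fun i => (T.1.symm i).1, fun i j h => T.1.symm.injective (Subtype.ext h), by
      ext x
      constructor
      · rintro ⟨i, rfl⟩
        exact (T.1.symm i).2
      · intro hx
        exact ⟨T.1 ⟨x, hx⟩, by simp⟩, by
      rintro i j (⟨h1, h2⟩ | ⟨h1, h2⟩)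
      · exact T.2.1 i j h1 h2
      · exact T.2.2 i j h1 h2⟩
  refine Nat.card_congr (Equiv.ofBijective F ⟨?_, ?_⟩)
  · intro T U h
    have h' : T.1.symm = U.1.symm := Equiv.ext fun i =>
      Subtype.ext (congrFun (congrArg Subtype.val h) i)
    exact Subtype.ext (by simpa using congrArg Equiv.symm h')
  · rintro ⟨g, hinj, hrange, hg⟩
    have hmem : ∀ i, g i ∈ D := fun i => by
      rw [← Finset.mem_coe, ← hrange]
      exact ⟨i, rfl⟩
    let e : Fin m ≃ D := Equiv.ofBijective (fun i => ⟨g i, hmem i⟩)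
      ⟨fun i j h => hinj (congrArg Subtype.val h), fun x => by
        obtain ⟨i, hi⟩ := (hrange ▸ x.2 : x.1 ∈ Set.range g)
        exact ⟨i, Subtype.ext hi⟩⟩
    refine ⟨⟨e.symm, ?_, ?_⟩, rfl⟩
    · intro i j h1 h2
      exact hg i j (Or.inl ⟨h1, h2⟩)
    · intro i j h1 h2
      exact hg i j (Or.inr ⟨h1, h2⟩)

instance finite_standardWords (D : Finset (ℕ × ℕ)) (m : ℕ) : Finite (standardWords D m) := by
  refine Set.Finite.to_subtype (Set.Finite.subset (Set.Finite.pi' fun _ => D.finite_toSet) ?_)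
  rintro g ⟨-, hrange, -⟩ i
  rw [← hrange]
  exact ⟨i, rfl⟩

theorem card_standardWords_zero : Nat.card (standardWords ∅ 0) = 1 := by
  rw [Nat.card_eq_one_iff_unique]
  refine ⟨⟨fun g h => Subtype.ext (Subsingleton.elim _ _)⟩, ⟨⟨Fin.elim0, ?_, ?_, ?_⟩⟩⟩
  · exact fun i => i.elim0
  · simp
  · exact fun i => i.elim0

open Classical in
/-- The cells of `D` that are last in their row and in their column. -/
def corners (D : Finset (ℕ × ℕ)) : Finset (ℕ × ℕ) :=
  D.filter fun x => ∀ y ∈ D, ¬ Before x y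

theorem snoc_mem_standardWords {D : Finset (ℕ × ℕ)} {m : ℕ} {x : ℕ × ℕ} {g : Fin m → ℕ × ℕ} :
    (Fin.snoc g x : Fin (m + 1) → ℕ × ℕ) ∈ standardWords D (m + 1) ↔
      x ∈ corners D ∧ g ∈ standardWords (D.erase x) m := by
  have hrange : Set.range (Fin.snoc g x : Fin (m + 1) → ℕ × ℕ) = insert x (Set.range g) := by
    ext y
    simp only [Set.mem_range, Set.mem_insert_iff, Fin.exists_fin_succ', Fin.snoc_castSucc,
      Fin.snoc_last]
    tauto
  simp only [standardWords, Set.mem_ofPred_eq, hrange, Fin.snoc_injective_iff, corners,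
    Finset.mem_filter]
  constructor
  · rintro ⟨⟨hinj, hx⟩, hD, hg⟩
    refine ⟨⟨?_, ?_⟩, hinj, ?_, ?_⟩
    · rw [← Finset.mem_coe, ← hD]
      exact Set.mem_insert _ _
    · intro y hy hxy
      rw [← Finset.mem_coe, ← hD] at hy
      rcases hy with rfl | ⟨i, rfl⟩
      · have := hg (Fin.last m) (Fin.last m) (by simpa using hxy)
        exact this.ne rfl
      · have := hg (Fin.last m) i.castSucc (by simpa using hxy)
        exact (Fin.le_last _).not_gt this
    · rw [Finset.coe_erase, ← hD, Set.insert_sdiff_of_mem _ (Set.mem_singleton x),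
        Set.sdiff_singleton_eq_self hx]
    · intro i j hij
      exact Fin.castSucc_lt_castSucc_iff.1 (hg i.castSucc j.castSucc (by simpa using hij))
  · rintro ⟨⟨hx, hmax⟩, hinj, hD, hg⟩
    have hmem : ∀ i, g i ∈ D := fun i =>
      Finset.mem_of_mem_erase (Finset.mem_coe.1 (hD ▸ Set.mem_range_self i))
    refine ⟨⟨hinj, ?_⟩, ?_, ?_⟩
    · rw [hD]
      simp
    · rw [hD, ← Finset.coe_insert, Finset.insert_erase hx]
    · intro i j
      refine Fin.lastCases ?_ (fun i => ?_) i
      · refine Fin.lastCases ?_ (fun j => ?_) j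
        · intro h
          exact absurd (by simpa using h) (hmax x hx)
        · intro h
          exact absurd (by simpa using h) (hmax (g j) (hmem j))
      · refine Fin.lastCases ?_ (fun j => ?_) j
        · exact fun _ => Fin.castSucc_lt_last i
        · intro h
          exact Fin.castSucc_lt_castSucc_iff.2 (hg i j (by simpa using h))

/-- Branching rule: the largest entry of a standard tableau sits in a corner. -/
theorem card_standardWords_succ (D : Finset (ℕ × ℕ)) (m : ℕ) :
    Nat.card (standardWords D (m + 1)) =
      ∑ x ∈ corners D, Nat.card (standardWords (D.erase x) m) := by
  let F : (Σ x : corners D, standardWords (D.erase x) m) → standardWords D (m + 1) := fun p =>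
    ⟨Fin.snoc p.2.1 p.1.1, snoc_mem_standardWords.2 ⟨p.1.2, p.2.2⟩⟩
  have hF : Function.Bijective F := by
    constructor
    · rintro ⟨⟨x, hx⟩, g, hg⟩ ⟨⟨x', hx'⟩, g', hg'⟩ h
      have h' : (Fin.snoc g x : Fin (m + 1) → ℕ × ℕ) = Fin.snoc g' x' := congrArg Subtype.val h
      obtain ⟨h1, h2⟩ := Fin.snoc_injective2 h'
      subst h1 h2
      rfl
    · rintro ⟨g, hg⟩
      rw [← Fin.snoc_init_self g] at hg
      obtain ⟨h1, h2⟩ := snoc_mem_standardWords.1 hg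
      exact ⟨⟨⟨_, h1⟩, ⟨_, h2⟩⟩, Subtype.ext (Fin.snoc_init_self g)⟩
  rw [← Nat.card_congr (Equiv.ofBijective F hF), Nat.card_sigma,
    Finset.sum_coe_sort (corners D) fun x => Nat.card (standardWords (D.erase x) m)]

/-! ### Skew shapes given by row lengths -/

variable {t : ℕ}

/-- The cells of the skew shape with row lengths `a` and `b`. -/
def shape (a b : Fin t → ℕ) : Finset (ℕ × ℕ) :=
  Finset.univ.biUnion fun i => (Finset.Ico (b i) (a i)).image fun c => (i.1, c)

theorem mem_shape {a b : Fin t → ℕ} {x : ℕ × ℕ} :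
    x ∈ shape a b ↔ ∃ i : Fin t, i.1 = x.1 ∧ b i ≤ x.2 ∧ x.2 < a i := by
  simp only [shape, Finset.mem_biUnion, Finset.mem_univ, true_and, Finset.mem_image,
    Finset.mem_Ico]
  constructor
  · rintro ⟨i, c, ⟨h1, h2⟩, rfl⟩
    exact ⟨i, rfl, h1, h2⟩
  · rintro ⟨i, hi, h1, h2⟩
    exact ⟨i, x.2, ⟨h1, h2⟩, Prod.ext hi rfl⟩

theorem mk_mem_shape {a b : Fin t → ℕ} {i : Fin t} {c : ℕ} :
    (i.1, c) ∈ shape a b ↔ b i ≤ c ∧ c < a i := by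
  rw [mem_shape]
  constructor
  · rintro ⟨j, hj, h⟩
    rwa [Fin.ext hj] at h
  · exact fun h => ⟨i, rfl, h⟩

/-- The rows of a skew shape whose last cell is a corner. -/
def removableRows (a b : Fin t → ℕ) : Finset (Fin t) :=
  Finset.univ.filter fun i => b i < a i ∧ ∀ j, i < j → a j < a i

theorem mem_removableRows {a b : Fin t → ℕ} {i : Fin t} :
    i ∈ removableRows a b ↔ b i < a i ∧ ∀ j, i < j → a j < a i := by
  simp [removableRows]

theorem corners_shape {a b : Fin t → ℕ} (hb : Antitone b) :
    corners (shape a b) = (removableRows a b).image fun i => (i.1, a i - 1) := by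
  ext ⟨r, c⟩
  simp only [corners, Finset.mem_filter, Finset.mem_image, mem_removableRows]
  constructor
  · rintro ⟨hx, hmax⟩
    obtain ⟨i, rfl, h1, h2⟩ := mem_shape.1 hx
    dsimp at h1 h2
    have hc : a i - 1 = c := by
      by_contra hne
      exact hmax (i.1, c + 1) (mk_mem_shape.2 ⟨by omega, by omega⟩)
        (Or.inl ⟨rfl, Nat.lt_succ_self c⟩)
    refine ⟨i, ⟨by omega, fun j hij => ?_⟩, by rw [hc]⟩
    by_contra hj
    have h3 := hb hij.le
    exact hmax (j.1, c) (mk_mem_shape.2 ⟨by omega, by omega⟩) (Or.inr ⟨rfl, hij⟩)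
  · rintro ⟨i, ⟨h1, h2⟩, h⟩
    obtain ⟨rfl, rfl⟩ := Prod.mk.inj h
    refine ⟨mk_mem_shape.2 ⟨by omega, by omega⟩, ?_⟩
    rintro ⟨r, c⟩ hy hbefore
    obtain ⟨j, rfl, h3, h4⟩ := mem_shape.1 hy
    dsimp at h3 h4
    rcases hbefore with ⟨h5, h6⟩ | ⟨h5, h6⟩
    · dsimp at h5 h6
      obtain rfl := Fin.ext h5
      omega
    · dsimp at h5 h6
      have := h2 j h6
      omega

theorem erase_shape {a b : Fin t → ℕ} {i : Fin t} (hi : b i < a i) :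
    (shape a b).erase (i.1, a i - 1) = shape (Function.update a i (a i - 1)) b := by
  ext ⟨r, c⟩
  rw [Finset.mem_erase, mem_shape, mem_shape]
  constructor
  · rintro ⟨hne, j, rfl, h1, h2⟩
    refine ⟨j, rfl, h1, ?_⟩
    by_cases hj : j = i
    · subst hj
      have : c ≠ a j - 1 := by
        rintro rfl
        exact hne rfl
      rw [Function.update_self]
      dsimp at h2 ⊢
      omega
    · rwa [Function.update_of_ne hj]
  · rintro ⟨j, rfl, h1, h2⟩
    by_cases hj : j = i
    · subst hj
      rw [Function.update_self] at h2
      dsimp at h1 h2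
      refine ⟨fun h => ?_, j, rfl, h1, by dsimp; omega⟩
      have := (Prod.mk.inj h).2
      omega
    · rw [Function.update_of_ne hj] at h2
      exact ⟨fun h => hj (Fin.ext (Prod.mk.inj h).1), j, rfl, h1, h2⟩

theorem card_standardWords_shape_succ {a b : Fin t → ℕ} (hb : Antitone b) (m : ℕ) :
    Nat.card (standardWords (shape a b) (m + 1)) =
      ∑ i ∈ removableRows a b,
        Nat.card (standardWords (shape (Function.update a i (a i - 1)) b) m) := by
  rw [card_standardWords_succ, corners_shape hb, Finset.sum_image]
  · refine Finset.sum_congr rfl fun i hi => ?_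
    rw [erase_shape (mem_removableRows.1 hi).1]
  · intro i _ j _ h
    exact Fin.ext (Prod.mk.inj h).1

/-! ### Aitken's determinant -/

/-- The reciprocal `1 / z!` of the factorial, with the value `0` at the negative integers. -/
def invFactorial (z : ℤ) : ℂ := if z < 0 then 0 else ((z.toNat.factorial : ℕ) : ℂ)⁻¹

theorem invFactorial_of_neg {z : ℤ} (hz : z < 0) : invFactorial z = 0 := if_pos hz

theorem invFactorial_natCast (n : ℕ) : invFactorial n = ((n.factorial : ℕ) : ℂ)⁻¹ := by
  simp [invFactorial]

theorem mul_invFactorial (z : ℤ) : z * invFactorial z = invFactorial (z - 1) := by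
  rcases lt_trichotomy z 0 with h | rfl | h
  · rw [invFactorial_of_neg h, invFactorial_of_neg (by omega), mul_zero]
  · rw [Int.cast_zero, zero_mul, invFactorial_of_neg (by norm_num)]
  · obtain ⟨n, rfl⟩ : ∃ n : ℕ, z = (n + 1 : ℕ) := ⟨(z - 1).toNat, by omega⟩
    rw [show ((n + 1 : ℕ) : ℤ) - 1 = (n : ℕ) by push_cast; ring, invFactorial_natCast,
      invFactorial_natCast, Nat.factorial_succ]
    have : ((n : ℂ) + 1) ≠ 0 := Nat.cast_add_one_ne_zero n
    push_cast
    field_simp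

/-- The matrix `1 / (a_i - b_j - i + j)!` of Aitken's determinant formula. The row lengths are
integers, so that lowering a row length by one always makes sense. -/
def aitken (a b : Fin t → ℤ) : Matrix (Fin t) (Fin t) ℂ :=
  Matrix.of fun i j => invFactorial (a i - b j - (i.1 : ℤ) + (j.1 : ℤ))

theorem aitken_apply (a b : Fin t → ℤ) (i j : Fin t) :
    aitken a b i j = invFactorial (a i - b j - (i.1 : ℤ) + (j.1 : ℤ)) := rfl

/-- In every term of the Leibniz expansion the arguments of the factorials add up to the number of
cells `∑ i, (a i - b i)`, and multiplying `1 / z!` by `z` gives `1 / (z - 1)!`; so multiplying the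
determinant by the number of cells lowers each row length in turn. -/
theorem sum_mul_det_aitken (a b : Fin t → ℤ) :
    ((∑ i, (a i - b i) : ℤ) : ℂ) * (aitken a b).det =
      ∑ i, (aitken (Function.update a i (a i - 1)) b).det := by
  simp only [Matrix.det_apply']
  rw [Finset.sum_comm, Finset.mul_sum]
  refine Finset.sum_congr rfl fun s _ => ?_
  rw [← Finset.mul_sum, mul_left_comm]
  congr 1
  have hsum : ∑ i, (a i - b i) =
      ∑ j, (a (s j) - b j - ((s j).1 : ℤ) + (j.1 : ℤ)) := by
    simp only [Finset.sum_add_distrib, Finset.sum_sub_distrib]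
    rw [Equiv.sum_comp s a, Equiv.sum_comp s fun i : Fin t => (i.1 : ℤ)]
    ring
  rw [hsum, Int.cast_sum, Finset.sum_mul,
    ← Equiv.sum_comp s fun i => ∏ l, aitken (Function.update a i (a i - 1)) b (s l) l]
  refine Finset.sum_congr rfl fun j _ => ?_
  rw [← Finset.mul_prod_erase _ _ (Finset.mem_univ j),
    ← Finset.mul_prod_erase _ _ (Finset.mem_univ j), ← mul_assoc]
  congr 1
  · rw [aitken_apply, aitken_apply, mul_invFactorial, Function.update_self]
    congr 1
    ring
  · refine Finset.prod_congr rfl fun l hl => ?_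
    rw [aitken_apply, aitken_apply,
      Function.update_of_ne fun h => (Finset.mem_erase.1 hl).1 (s.injective h)]

/-- A block of zeros that reaches the diagonal entry `(i, i)` from below kills the determinant. -/
theorem det_eq_zero_of_block {A : Matrix (Fin t) (Fin t) ℂ} (i : Fin t)
    (hA : ∀ r c, i ≤ r → c ≤ i → A r c = 0) : A.det = 0 := by
  rw [Matrix.det_apply]
  refine Finset.sum_eq_zero fun s _ => ?_
  obtain ⟨j, hj, hsj⟩ : ∃ j ≤ i, i ≤ s j := by
    by_contra! h
    have h1 : (Finset.Iic i).card ≤ (Finset.Iio i).card :=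
      Finset.card_le_card_of_injOn s (fun j hj => by simpa using h j (by simpa using hj))
        s.injective.injOn
    rw [Fin.card_Iic, Fin.card_Iio] at h1
    omega
  have hprod : ∏ l, A (s l) l = 0 := Finset.prod_eq_zero (Finset.mem_univ j) (hA _ _ hsj hj)
  rw [hprod, smul_zero]

/-- The rows that do not end in a corner do not contribute to `sum_mul_det_aitken`: shortening such
a row produces a block of zeros or two equal rows. -/
theorem det_aitken_update_eq_zero {a b : Fin t → ℕ} (ha : Antitone a) (hb : Antitone b)
    (hba : b ≤ a) {i : Fin t} (hi : i ∉ removableRows a b) :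
    (aitken (Function.update (fun j => (a j : ℤ)) i (a i - 1)) fun j => (b j : ℤ)).det = 0 := by
  rw [mem_removableRows, not_and_or] at hi
  rcases hi with hi | hi
  · have hai : a i = b i := le_antisymm (not_lt.1 hi) (hba i)
    refine det_eq_zero_of_block i fun r c hr hc => ?_
    rw [aitken_apply]
    refine invFactorial_of_neg ?_
    have h1 := hb hc
    have h2 := ha hr
    rcases hr.lt_or_eq with h | rfl
    · rw [Function.update_of_ne h.ne']
      omega
    · rw [Function.update_self]
      omega
  · push Not at hi
    obtain ⟨j, hij, hj⟩ := hi
    -- Rows `i` and `i + 1` of the matrix agree.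
    let i' : Fin t := ⟨i.1 + 1, by omega⟩
    have hne : i ≠ i' := fun h => by simpa [i'] using congrArg Fin.val h
    have h1 : a i' ≤ a i := ha (Fin.le_def.2 (Nat.le_succ _))
    have h2 : a j ≤ a i' := ha (Fin.le_def.2 hij)
    refine Matrix.det_zero_of_row_eq hne (funext fun c => ?_)
    rw [aitken_apply, aitken_apply, Function.update_self, Function.update_of_ne hne.symm]
    congr 1
    have h3 : a i = a i' := by omega
    rw [h3]
    simp only [i']
    push_cast
    ring

/-- Aitken's determinant formula for the number of standard tableaux of a skew shape. -/
theorem card_standardWords_shape {b : Fin t → ℕ} (hb : Antitone b) (m : ℕ) :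
    ∀ {a : Fin t → ℕ}, Antitone a → b ≤ a → ∑ i, a i = ∑ i, b i + m →
      (Nat.card (standardWords (shape a b) m) : ℂ) =
        (m.factorial : ℂ) * (aitken (fun i => (a i : ℤ)) fun i => (b i : ℤ)).det := by
  induction m with
  | zero =>
    intro a ha hba hsum
    have hab : a = b := by
      funext i
      refine le_antisymm ?_ (hba i)
      by_contra h
      have := Finset.sum_lt_sum (fun i _ => hba i) ⟨i, Finset.mem_univ i, not_le.1 h⟩
      omega
    subst hab
    have hempty : shape a a = ∅ := by
      ext x
      simp only [mem_shape, Finset.notMem_empty, iff_false]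
      rintro ⟨i, -, h1, h2⟩
      omega
    rw [hempty, card_standardWords_zero, Matrix.det_of_isUpperTriangular]
    · simp [aitken_apply, invFactorial]
    · intro i j hij
      have h1 : j < i := hij
      have h2 := ha h1.le
      exact invFactorial_of_neg (by dsimp; omega)
  | succ m ih =>
    intro a ha hba hsum
    have hdet := sum_mul_det_aitken (fun i => (a i : ℤ)) fun i => (b i : ℤ)
    have hm : ∑ i, ((a i : ℤ) - (b i : ℤ)) = (m + 1 : ℕ) := by
      rw [Finset.sum_sub_distrib, ← Nat.cast_sum, ← Nat.cast_sum]
      omega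
    rw [hm] at hdet
    rw [card_standardWords_shape_succ hb, Nat.factorial_succ, Nat.cast_mul,
      mul_comm ((m + 1 : ℕ) : ℂ), mul_assoc]
    push_cast at hdet ⊢
    rw [hdet, ← Finset.sum_subset (Finset.subset_univ (removableRows a b))
      fun i _ hi => det_aitken_update_eq_zero ha hb hba hi, Finset.mul_sum]
    refine Finset.sum_congr rfl fun i hi => ?_
    rw [mem_removableRows] at hi
    have hcast : (Function.update (fun j => (a j : ℤ)) i ((a i : ℤ) - 1)) =
        fun j => ((Function.update a i (a i - 1) j : ℕ) : ℤ) := by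
      funext j
      by_cases hj : j = i
      · subst hj
        rw [Function.update_self, Function.update_self]
        omega
      · rw [Function.update_of_ne hj, Function.update_of_ne hj]
    rw [hcast]
    refine ih ?_ ?_ ?_
    · intro j l hjl
      by_cases hl : l = i
      · subst hl
        rw [Function.update_self]
        by_cases hj : j = l
        · rw [hj, Function.update_self]
        · rw [Function.update_of_ne hj]
          exact (Nat.sub_le _ _).trans (ha hjl)
      · rw [Function.update_of_ne hl]
        by_cases hj : j = i
        · subst hj
          rw [Function.update_self]
          have := hi.2 l (lt_of_le_of_ne hjl (Ne.symm hl))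
          omega
        · rw [Function.update_of_ne hj]
          exact ha hjl
    · intro j
      by_cases hj : j = i
      · subst hj
        rw [Function.update_self]
        exact Nat.le_sub_one_of_lt hi.1
      · rw [Function.update_of_ne hj]
        exact hba j
    · have h1 := Finset.sum_update_of_mem (Finset.mem_univ i) a (a i - 1)
      have h2 := Finset.add_sum_erase Finset.univ a (Finset.mem_univ i)
      rw [h1, Finset.sdiff_singleton_eq_erase]
      omega

/-! ### Degrees as determinants, and the Laplace expansion -/

theorem card_shape {a b : Fin t → ℕ} (hba : b ≤ a) :
    ∑ i, a i = ∑ i, b i + (shape a b).card := by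
  rw [shape, Finset.card_biUnion, ← Finset.sum_add_distrib]
  · refine Finset.sum_congr rfl fun i _ => ?_
    rw [Finset.card_image_of_injective _ fun c c' h => (Prod.mk.inj h).2, Nat.card_Ico,
      Nat.add_sub_cancel' (hba i)]
  · intro i _ j _ hij
    rw [Function.onFun, Finset.disjoint_left]
    intro x hx hx'
    obtain ⟨c, -, rfl⟩ := Finset.mem_image.1 hx
    obtain ⟨c', -, h⟩ := Finset.mem_image.1 hx'
    exact hij (Fin.ext (Prod.mk.inj h).1.symm)

/-- Aitken's determinant formula for the degree of a skew Specht module. -/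
theorem skewDegree_eq_det {lam mu : YoungDiagram} {a b : Fin t → ℕ} (ha : Antitone a)
    (hb : Antitone b) (hba : b ≤ a) (h : cells lam mu = shape a b) {m : ℕ}
    (hm : ∑ i, a i = ∑ i, b i + m) :
    skewDegree lam mu =
      (m.factorial : ℂ) * (aitken (fun i => (a i : ℤ)) fun i => (b i : ℤ)).det := by
  have hsize : size lam mu = m := by
    have := card_shape hba
    rw [size, h]
    omega
  rw [skewDegree_eq_card, card_isStandard, hsize, h, card_standardWords_shape hb m ha hba hm]

theorem antitone_rowLen (lam : YoungDiagram) :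
    Antitone fun i : Fin t => lam.rowLen i.1 :=
  fun _ _ h => lam.rowLen_anti _ _ h

theorem fst_lt_length_of_mem {lam : YoungDiagram} {x : ℕ × ℕ} (hx : x ∈ lam) :
    x.1 < lam.rowLens.length := by
  rw [YoungDiagram.length_rowLens, ← YoungDiagram.mem_iff_lt_colLen]
  exact lam.up_left_mem le_rfl (Nat.zero_le _) hx

theorem cells_column (lam : YoungDiagram) (j : ℕ) :
    cells lam (column j) =
      shape (fun i : Fin lam.rowLens.length => lam.rowLen i.1)
        fun i => if i.1 < j then 1 else 0 := by
  ext ⟨r, c⟩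
  have hcol : (r, c) ∈ column j ↔ r < j ∧ c = 0 := by
    simp [column, YoungDiagram.mem_ofRowLens]
  rw [cells, Finset.mem_sdiff, YoungDiagram.mem_cells, YoungDiagram.mem_cells, hcol, mem_shape]
  constructor
  · rintro ⟨h1, h2⟩
    refine ⟨⟨r, fst_lt_length_of_mem h1⟩, rfl, ?_, YoungDiagram.mem_iff_lt_rowLen.1 h1⟩
    dsimp
    split_ifs <;> omega
  · rintro ⟨i, rfl, h1, h2⟩
    refine ⟨YoungDiagram.mem_iff_lt_rowLen.2 h2, ?_⟩
    dsimp at h1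
    split_ifs at h1 <;> omega

theorem cells_addRow {n : ℕ} {lam : YoungDiagram} (hn : lam.rowLen 0 ≤ n) :
    cells (addRow n lam hn) ⊥ =
      shape (Fin.cons n fun i : Fin lam.rowLens.length => lam.rowLen i.1) 0 := by
  ext ⟨r, c⟩
  have hbot : (r, c) ∈ cells (addRow n lam hn) ⊥ ↔ (r, c) ∈ addRow n lam hn := by
    simp [cells]
  rw [hbot, addRow, YoungDiagram.mem_ofRowLens, mem_shape, Fin.exists_fin_succ]
  rcases r with _ | r
  · simp
  · constructor
    · rintro ⟨h1, h2⟩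
      refine Or.inr ⟨⟨r, by simpa using h1⟩, rfl, Nat.zero_le _, ?_⟩
      rw [Fin.cons]
      simpa using h2
    · rintro (⟨h, -⟩ | ⟨i, h1, -, h2⟩)
      · simp at h
      · obtain rfl : i.1 = r := by simpa using h1
        exact ⟨by simpa using i.2, by simpa using h2⟩

theorem sum_rowLen (lam : YoungDiagram) :
    ∑ i : Fin lam.rowLens.length, lam.rowLen i.1 = lam.card := by
  have h := card_shape (a := fun i : Fin lam.rowLens.length => lam.rowLen i.1) (b := 0)
    fun _ => Nat.zero_le _
  rw [h, YoungDiagram.card]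
  simp only [Pi.zero_apply, Finset.sum_const_zero, zero_add]
  congr 1
  ext ⟨r, c⟩
  rw [mem_shape, YoungDiagram.mem_cells]
  constructor
  · rintro ⟨i, rfl, -, h⟩
    exact YoungDiagram.mem_iff_lt_rowLen.2 h
  · intro h
    exact ⟨⟨r, fst_lt_length_of_mem h⟩, rfl, Nat.zero_le _, YoungDiagram.mem_iff_lt_rowLen.1 h⟩

/-- Laplace expansion along row `0`: the minor without row `0` and column `j` is the Aitken matrix
of the shape from which the column `(1^j)` is removed. -/
theorem det_aitken_cons (n : ℕ) (a : Fin t → ℕ) :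
    (aitken (fun i => ((Fin.cons n a : Fin (t + 1) → ℕ) i : ℤ)) fun _ => 0).det =
      ∑ j ∈ Finset.range (t + 1), (-1 : ℂ) ^ j * (((n + j).factorial : ℕ) : ℂ)⁻¹ *
        (aitken (fun i => (a i : ℤ)) fun i : Fin t =>
          ((if i.1 < j then 1 else 0 : ℕ) : ℤ)).det := by
  rw [Matrix.det_succ_row_zero, Finset.sum_range]
  refine Finset.sum_congr rfl fun j _ => ?_
  have hentry : aitken (fun i => ((Fin.cons n a : Fin (t + 1) → ℕ) i : ℤ)) (fun _ => 0) 0 j =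
      (((n + j.1).factorial : ℕ) : ℂ)⁻¹ := by
    rw [aitken_apply, ← invFactorial_natCast]
    simp
  have hminor : (aitken (fun i => ((Fin.cons n a : Fin (t + 1) → ℕ) i : ℤ))
      fun _ => 0).submatrix Fin.succ j.succAbove =
        aitken (fun i => (a i : ℤ)) fun i : Fin t =>
          ((if i.1 < j.1 then 1 else 0 : ℕ) : ℤ) := by
    ext r c
    rw [Matrix.submatrix_apply, aitken_apply, aitken_apply, Fin.cons_succ]
    congr 1
    -- Deleting column `j` shifts the column index by one exactly from `j` on.
    by_cases h : c.1 < j.1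
    · rw [Fin.succAbove_of_castSucc_lt _ _ h, if_pos h, Fin.val_succ, Fin.val_castSucc]
      push_cast
      ring
    · rw [Fin.succAbove_of_le_castSucc _ _ (not_lt.1 h), if_neg h, Fin.val_succ, Fin.val_succ]
      push_cast
      ring
  rw [hentry, hminor]

theorem degree_addRow {n : ℕ} {lam : YoungDiagram} (hn : lam.rowLen 0 ≤ n) :
    degree (addRow n lam hn) =
      ∑ j ∈ Finset.range (lam.rowLens.length + 1),
        (-1 : ℂ) ^ j * ((n + lam.card).choose (lam.card - j) : ℂ) *
          skewDegree lam (column j) := by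
  have hcons : Antitone (Fin.cons n fun i : Fin lam.rowLens.length => lam.rowLen i.1 :
      Fin (lam.rowLens.length + 1) → ℕ) := by
    intro i l hil
    induction i using Fin.cases with
    | zero =>
      induction l using Fin.cases with
      | zero => exact le_rfl
      | succ l => exact (lam.rowLen_anti _ _ (Nat.zero_le _)).trans hn
    | succ i =>
      induction l using Fin.cases with
      | zero => exact absurd hil (Fin.succ_pos i).not_ge
      | succ l => exact antitone_rowLen lam (Fin.succ_le_succ_iff.1 hil)
  have hrow : ∀ i : Fin lam.rowLens.length, 0 < lam.rowLen i.1 := fun i => by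
    rw [← YoungDiagram.mem_iff_lt_rowLen, YoungDiagram.mem_iff_lt_colLen,
      ← YoungDiagram.length_rowLens]
    exact i.2
  rw [degree, skewDegree_eq_det (m := n + lam.card) hcons antitone_const
    (fun _ => Nat.zero_le _) (cells_addRow hn) (by simp [Fin.sum_univ_succ, sum_rowLen])]
  simp only [Nat.cast_zero]
  rw [det_aitken_cons, Finset.mul_sum]
  refine Finset.sum_congr rfl fun j hj => ?_
  have hjt : j ≤ lam.rowLens.length := Nat.lt_succ_iff.1 (Finset.mem_range.1 hj)
  have hle : (fun i : Fin lam.rowLens.length => if i.1 < j then 1 else 0) ≤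
      fun i => lam.rowLen i.1 := by
    intro i
    have := hrow i
    dsimp
    split_ifs <;> omega
  have hsum : ∑ i : Fin lam.rowLens.length, (if i.1 < j then 1 else 0) = j := by
    rw [← Finset.card_filter, Fin.card_filter_val_lt, min_eq_right hjt]
  have hjk : j ≤ lam.card := by
    rw [← hsum, ← sum_rowLen]
    exact Finset.sum_le_sum fun i _ => hle i
  rw [skewDegree_eq_det (m := lam.card - j) (antitone_rowLen lam) (fun i l hil => by
      have : i.1 ≤ l.1 := hil
      split_ifs <;> omega) hle (cells_column lam j)
      (by rw [hsum, sum_rowLen]; omega)]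
  have hchoose : ((n + lam.card).choose (lam.card - j) : ℂ) =
      ((n + lam.card).factorial : ℂ) / (((lam.card - j).factorial : ℂ) * (n + j).factorial) := by
    rw [Nat.cast_choose ℂ (by omega),
      show n + lam.card - (lam.card - j) = n + j by omega]
  have h1 : ((lam.card - j).factorial : ℂ) ≠ 0 := Nat.cast_ne_zero.2 (Nat.factorial_ne_zero _)
  rw [hchoose]
  field_simp

end Counting

end SkewSpecht

end

theorem theorem1 (k t n : ℕ) (lam : YoungDiagram) (hk : lam.card = k)
    (ht : lam.rowLens.length = t) (hn : lam.rowLen 0 ≤ n) :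
    SkewSpecht.degree (SkewSpecht.addRow n lam hn) =
      ∑ j ∈ Finset.range (t + 1),
        (-1 : ℂ) ^ j * ((n + k).choose (k - j) : ℂ) *
          SkewSpecht.skewDegree lam (SkewSpecht.column j) := by
  subst hk ht
  exact SkewSpecht.degree_addRow hn
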